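/- **Theorem 4.2** (Lieb–Ruskai strong subadditivity and equivalents). All Hilbert spaces are finite dimensional and complex, and are identified with coordinate spaces by means of orthonormal bases, so that operators are matrices, indexed on a tensor product by the product of the index sets. A density matrix is a positive semidefinite matrix of trace one. For a positive semidefinite matrix $\rho$ put $S(\rho)=-\mathrm{Tr}[\rho\log\rho]$, with $0\log 0=0$. For positive semidefinite $\rho,\sigma$ put $D(\rho\|\sigma)=\mathrm{Tr}[\rho(\log\rho-\log\sigma)]$ if $\ker\sigma\subseteq\ker\rho$ (where $\log\sigma$ is set to $0$ on $\ker\sigma$, and likewise for $\rho$), and $D(\rho\|\sigma)=+\infty$ otherwise. For a matrix on a tensor product, subscripts denote the partial traces onto the indicated factors, e.g. $\rho_{12}=\mathrm{Tr}_3[\rho_{123}]$ and $\rho_2=\mathrm{Tr}_1[\rho_{12}]$, and $S_{12}=S(\rho_{12})$, etc. The following three statements are all true, and they are equivalent to each other: 1. For all $\mathcal H_1,\mathcal H_2,\mathcal H_3$ and all density matrices $\rho_{123}$ on $\mathcal H_1\otimes\mathcal H_2\otimes\mathcal H_3$, $$S_{12}+S_{23}\ \ge\ S_{123}+S_2 .$$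 2. For all $\mathcal H_1,\mathcal H_2$, the map $\rho_{12}\mapsto S_2-S_{12}$ is convex on the set of density matrices on $\mathcal H_1\otimes\mathcal H_2$; on the cone of all positive semidefinite matrices on $\mathcal H_1\otimes\mathcal H_2$ it is convex and homogeneous of degree one, i.e. its value at $t\rho_{12}$ is $t$ times its value at $\rho_{12}$ for all real $t\ge 0$. 3. The relative entropy is monotone under partial traces: for all $\mathcal H_1,\mathcal H_2$ and all density matrices $\rho_{12},\sigma_{12}$ on $\mathcal H_1\otimes\mathcal H_2$, $$D(\rho_1\|\sigma_1)\le D(\rho_{12}\|\sigma_{12})\quad\text{and}\quad D(\rho_2\|\sigma_2)\le D(\rho_{12}\|\sigma_{12}).$$ -/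

import Mathlib

open scoped Matrix ComplexOrder

universe u

namespace QuantumEntropy

noncomputable section

/-- A density matrix on the Hilbert space `ℂ^n` (with `n` a finite index set):
a positive semidefinite matrix of trace one. -/
def IsDensityMatrix {n : Type u} [Fintype n] (ρ : Matrix n n ℂ) : Prop :=
  ρ.PosSemidef ∧ ρ.trace = 1

/-- The partial trace over the first factor of `ℂ^m ⊗ ℂ^n = ℂ^(m × n)`:
`ρ₁₂ ↦ ρ₂`. -/
def ptraceFst {m n : Type u} [Fintype m] (ρ : Matrix (m × n) (m × n) ℂ) : Matrix n n ℂ :=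
  Matrix.of fun j j' => ∑ i, ρ (i, j) (i, j')

/-- The partial trace over the second factor of `ℂ^m ⊗ ℂ^n = ℂ^(m × n)`:
`ρ₁₂ ↦ ρ₁`. -/
def ptraceSnd {m n : Type u} [Fintype n] (ρ : Matrix (m × n) (m × n) ℂ) : Matrix m m ℂ :=
  Matrix.of fun i i' => ∑ j, ρ (i, j) (i', j)

/-- The logarithm of a Hermitian matrix through the spectral functional calculus.
It vanishes on the kernel, in agreement with the conventions `0 log 0 = 0` below. -/
def matrixLog {n : Type u} [Fintype n] [DecidableEq n] (A : Matrix n n ℂ) : Matrix n n ℂ :=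
  cfc Real.log A

/-- The von Neumann entropy `S(ρ) = -Tr[ρ log ρ]`, given by the same formula
for every positive semidefinite `ρ`, normalized or not. -/
def entropy {n : Type u} [Fintype n] [DecidableEq n] (ρ : Matrix n n ℂ) : ℝ :=
  -(ρ * matrixLog ρ).trace.re

open Classical in
/-- The (Umegaki) relative entropy `D(ρ‖σ) = Tr[ρ (log ρ - log σ)]` of positive semidefinite
matrices, with the value `+∞` unless `ker σ ⊆ ker ρ`. -/
def relativeEntropy {n : Type u} [Fintype n] [DecidableEq n] (ρ σ : Matrix n n ℂ) : EReal :=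
  if ∀ v : n → ℂ, σ *ᵥ v = 0 → ρ *ᵥ v = 0 then
    (((ρ * (matrixLog ρ - matrixLog σ)).trace.re : ℝ) : EReal)
  else ⊤

/-- Strong subadditivity, `S₁₂₃ + S₂ ≤ S₁₂ + S₂₃`. The tripartite system is indexed by
`a × b × c = a × (b × c)`; `ρ₁₂` is obtained after regrouping it as `(a × b) × c`. -/
def StrongSubadditivity : Prop :=
  ∀ (a b c : Type u) [Fintype a] [DecidableEq a] [Fintype b] [DecidableEq b]
    [Fintype c] [DecidableEq c] (ρ₁₂₃ : Matrix (a × b × c) (a × b × c) ℂ),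
    IsDensityMatrix ρ₁₂₃ →
    let ρ₁₂ : Matrix (a × b) (a × b) ℂ :=
      ptraceSnd (Matrix.reindex (Equiv.prodAssoc a b c).symm (Equiv.prodAssoc a b c).symm ρ₁₂₃)
    let ρ₂₃ : Matrix (b × c) (b × c) ℂ := ptraceFst ρ₁₂₃
    let ρ₂ : Matrix b b ℂ := ptraceFst ρ₁₂
    entropy ρ₁₂ + entropy ρ₂₃ ≥ entropy ρ₁₂₃ + entropy ρ₂

/-- The map `ρ₁₂ ↦ S₂ - S₁₂` on matrices over a bipartite system. -/
def entropyDiff {a b : Type u} [Fintype a] [DecidableEq a] [Fintype b] [DecidableEq b]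
    (ρ₁₂ : Matrix (a × b) (a × b) ℂ) : ℝ :=
  entropy (ptraceFst ρ₁₂) - entropy ρ₁₂

/-- The map `ρ₁₂ ↦ S₂ - S₁₂` is convex, both on the set of density matrices and on the cone of
all positive semidefinite matrices spanned by it, and on this cone it is homogeneous of degree
one. -/
def EntropyDiffConvexHomogeneous : Prop :=
  ∀ (a b : Type u) [Fintype a] [DecidableEq a] [Fintype b] [DecidableEq b],
    ConvexOn ℝ {ρ₁₂ : Matrix (a × b) (a × b) ℂ | IsDensityMatrix ρ₁₂} entropyDiff ∧
    ConvexOn ℝ {ρ₁₂ : Matrix (a × b) (a × b) ℂ | ρ₁₂.PosSemidef} entropyDiff ∧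
    ∀ ρ₁₂ : Matrix (a × b) (a × b) ℂ, ρ₁₂.PosSemidef →
      ∀ t : ℝ, 0 ≤ t → entropyDiff (t • ρ₁₂) = t * entropyDiff ρ₁₂

/-- The relative entropy is monotone under the partial trace over either factor. -/
def RelativeEntropyMonotone : Prop :=
  ∀ (a b : Type u) [Fintype a] [DecidableEq a] [Fintype b] [DecidableEq b]
    (ρ₁₂ σ₁₂ : Matrix (a × b) (a × b) ℂ), IsDensityMatrix ρ₁₂ → IsDensityMatrix σ₁₂ →
    relativeEntropy (ptraceSnd ρ₁₂) (ptraceSnd σ₁₂) ≤ relativeEntropy ρ₁₂ σ₁₂ ∧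
    relativeEntropy (ptraceFst ρ₁₂) (ptraceFst σ₁₂) ≤ relativeEntropy ρ₁₂ σ₁₂

end

end QuantumEntropy

namespace QuantumEntropy

noncomputable section

open Filter Topology Matrix Kronecker

/-! All three statements follow from one variational formula. For positive `ρ`, `σ` with `ker σ ⊆
ker ρ`, let `Q t` be the maximum over `X` of `resolventForm t ρ σ X`. Then `Tr[ρ (log ρ - log σ)]`
is the limit of `∫₀ᵀ Q - Tr ρ · log T` as `T → ∞` (`exists_resolvent_representation`).

The form is linear in `(ρ, σ)`, so its maximum, and with it the relative entropy, is jointly convex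
(`umegaki_combo_le`). If `ρ`, `σ` are the restrictions of `ρ'`, `σ'` along a unital *-homomorphism
`φ`, the form at `X` equals the primed form at `φ X`, so the maximum can only grow: this is
monotonicity (`umegaki_mono_of_starAlgHom`).

Partial traces are restrictions along `1 ⊗ X` and `X ⊗ 1`. Since `S₂ - S₁₂ = D(ρ₁₂‖1 ⊗ ρ₂)`,
convexity is a case of joint convexity. Strong subadditivity is `D(ρ₂₃‖ρ₂ ⊗ 1) ≤ D(ρ₁₂₃‖ρ₁₂ ⊗ 1)`.
-/

/-! ### Resolvent representation of the relative entropy -/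

theorem exists_spectral_decomposition {n : Type*} [Fintype n] [DecidableEq n]
    {A : Matrix n n ℂ} (hA : A.PosSemidef) :
    ∃ (U : Matrix n n ℂ) (p : n → ℝ), U * Uᴴ = 1 ∧ Uᴴ * U = 1 ∧ (∀ i, 0 ≤ p i) ∧
      A = U * diagonal (fun i => (p i : ℂ)) * Uᴴ ∧
      matrixLog A = U * diagonal (fun i => (Real.log (p i) : ℂ)) * Uᴴ := by
  refine ⟨hA.1.eigenvectorUnitary, hA.1.eigenvalues, ?_, ?_, hA.eigenvalues_nonneg, ?_, ?_⟩
  · exact Unitary.coe_mul_star_self hA.1.eigenvectorUnitary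
  · exact Unitary.coe_star_mul_self hA.1.eigenvectorUnitary
  · exact hA.1.spectral_theorem
  · exact hA.1.cfc_eq Real.log

/-- The quadratic functional whose maximum over `X` is the value at `ρ^{1/2}` of the resolvent
`(Δ + t)⁻¹` of the relative modular operator `Δ` of `σ` and `ρ`. -/
def resolventForm {n : Type*} [Fintype n] (t : ℝ) (ρ σ X : Matrix n n ℂ) : ℝ :=
  2 * (ρ * X).trace.re - (σ * (X * Xᴴ)).trace.re - t * (ρ * (Xᴴ * X)).trace.re

/-- The real number `Tr[ρ (log ρ - log σ)]`. -/
def umegaki {n : Type*} [Fintype n] [DecidableEq n] (ρ σ : Matrix n n ℂ) : ℝ :=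
  (ρ * (matrixLog ρ - matrixLog σ)).trace.re

theorem trace_re_diagonal_mul {n : Type*} [Fintype n] [DecidableEq n] (p : n → ℝ)
    (A : Matrix n n ℂ) :
    (diagonal (fun i => (p i : ℂ)) * A).trace.re = ∑ i, p i * (A i i).re := by
  simp [trace, diagonal_mul]

/-- In the eigenbases of `ρ` and `σ` the form decouples into one scalar quadratic per entry of `Y`,
so it can be maximized entry by entry. -/
theorem resolventForm_conj {n : Type*} [Fintype n] [DecidableEq n] (t : ℝ)
    {U V : Matrix n n ℂ} (p q : n → ℝ)
    (hU : Uᴴ * U = 1) (hV : Vᴴ * V = 1) (Y : Matrix n n ℂ) :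
    resolventForm t (U * diagonal (fun i => (p i : ℂ)) * Uᴴ)
      (V * diagonal (fun i => (q i : ℂ)) * Vᴴ) (V * Y * Uᴴ) =
    ∑ i, ∑ j, (2 * p i * ((Uᴴ * V) i j * Y j i).re
      - (q j + t * p i) * Complex.normSq (Y j i)) := by
  have h1 : (U * diagonal (fun i => (p i : ℂ)) * Uᴴ * (V * Y * Uᴴ)).trace =
      (diagonal (fun i => (p i : ℂ)) * (Uᴴ * V * Y)).trace := by
    rw [← mul_assoc (U * _ * Uᴴ), trace_mul_comm]
    simp only [← mul_assoc, hU, one_mul]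
  have h2 : (V * diagonal (fun i => (q i : ℂ)) * Vᴴ * (V * Y * Uᴴ * (V * Y * Uᴴ)ᴴ)).trace =
      (diagonal (fun i => (q i : ℂ)) * (Y * Yᴴ)).trace := by
    have : V * Y * Uᴴ * (V * Y * Uᴴ)ᴴ = V * (Y * Yᴴ) * Vᴴ := by
      simp only [conjTranspose_mul, conjTranspose_conjTranspose, mul_assoc]
      rw [← mul_assoc Uᴴ U, hU, one_mul]
    rw [this, ← mul_assoc (V * _ * Vᴴ), trace_mul_comm]
    simp only [← mul_assoc, hV, one_mul]
    rw [mul_assoc _ Vᴴ V, hV, mul_one]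
  have h3 : (U * diagonal (fun i => (p i : ℂ)) * Uᴴ * ((V * Y * Uᴴ)ᴴ * (V * Y * Uᴴ))).trace =
      (diagonal (fun i => (p i : ℂ)) * (Yᴴ * Y)).trace := by
    have : (V * Y * Uᴴ)ᴴ * (V * Y * Uᴴ) = U * (Yᴴ * Y) * Uᴴ := by
      simp only [conjTranspose_mul, conjTranspose_conjTranspose, mul_assoc]
      rw [← mul_assoc Vᴴ V, hV, one_mul]
    rw [this, ← mul_assoc (U * _ * Uᴴ), trace_mul_comm]
    simp only [← mul_assoc, hU, one_mul]
    rw [mul_assoc _ Uᴴ U, hU, mul_one]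
  have hn : ∀ z : ℂ, (z * star z).re = Complex.normSq z := fun z => by
    simp [Complex.normSq_apply]
  have hn' : ∀ z : ℂ, (star z * z).re = Complex.normSq z := fun z => by
    simp [Complex.normSq_apply]
  rw [resolventForm, h1, h2, h3, trace_re_diagonal_mul, trace_re_diagonal_mul,
    trace_re_diagonal_mul]
  simp only [mul_apply (M := Uᴴ * V), mul_apply (M := Y), mul_apply (M := Yᴴ),
    conjTranspose_apply, Complex.re_sum, hn, hn', Finset.mul_sum]
  rw [Finset.sum_comm (f := fun i j => q i * _), ← Finset.sum_sub_distrib,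
    ← Finset.sum_sub_distrib]
  refine Finset.sum_congr rfl fun i _ => ?_
  rw [← Finset.sum_sub_distrib, ← Finset.sum_sub_distrib]
  refine Finset.sum_congr rfl fun j _ => ?_
  ring

/-- Completing the square in one entry. -/
theorem two_mul_re_sub_le {p r : ℝ} (w y : ℂ) (hp : p = 0 ∨ 0 < r) (hr : 0 ≤ r) :
    2 * p * (w * y).re - r * Complex.normSq y ≤ p ^ 2 * Complex.normSq w / r := by
  rcases hp with rfl | hr'
  · have := mul_nonneg hr (Complex.normSq_nonneg y)
    simp [this]
  · rw [le_div_iff₀ hr']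
    have h := Complex.normSq_nonneg (r * y - p * star w)
    simp only [Complex.normSq_apply, Complex.sub_re, Complex.sub_im, Complex.mul_re,
      Complex.mul_im, Complex.ofReal_re, Complex.ofReal_im, Complex.star_def, Complex.conj_re,
      Complex.conj_im] at h ⊢
    nlinarith

/-- The bound of `two_mul_re_sub_le` is attained at `y = (p / r) * star w`. If `p = 0`, both sides
vanish even when `r = 0`. -/
theorem two_mul_re_sub_eq {p r : ℝ} (w : ℂ) (hp : p = 0 ∨ 0 < r) :
    2 * p * (w * ((p / r : ℝ) * star w)).re - r * Complex.normSq ((p / r : ℝ) * star w) =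
      p ^ 2 * Complex.normSq w / r := by
  rcases hp with rfl | hr'
  · simp
  · simp only [Complex.normSq_apply, Complex.mul_re,
      Complex.mul_im, Complex.ofReal_re, Complex.ofReal_im, Complex.star_def, Complex.conj_re,
      Complex.conj_im]
    field_simp
    ring

/-- The condition `h` is what the kernel inclusion provides. It keeps the denominator positive down
to `t = 0`, except in terms that vanish identically. -/
theorem hasDerivAt_logTerm {w p q : ℝ} (hp : 0 ≤ p) (h : w * p ≠ 0 → 0 < q) {t : ℝ}
    (ht : 0 ≤ t) :
    HasDerivAt (fun T => w * p * (Real.log (q + T * p) - Real.log q))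
      (p ^ 2 * w / (q + t * p)) t := by
  by_cases hw : w * p = 0
  · have : p ^ 2 * w / (q + t * p) = 0 := by
      rw [show p ^ 2 * w = p * (w * p) by ring, hw]; simp
    rw [this]
    simp only [hw, zero_mul]
    exact hasDerivAt_const t 0
  · have hq := h hw
    have hpos : 0 < q + t * p := by positivity
    have h1 : HasDerivAt (fun T => q + T * p) p t := by
      simpa using ((hasDerivAt_id t).mul_const p).const_add q
    have h2 := ((h1.log hpos.ne').sub_const (Real.log q)).const_mul (w * p)
    exact h2.congr_deriv (by ring)

/-- For `p > 0` the divergent part splits off through `log (q + T p) = log T + log (q / T + p)`. -/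
theorem tendsto_logTerm {w p q : ℝ} (hp : 0 ≤ p) :
    Tendsto (fun T => w * p * (Real.log (q + T * p) - Real.log q) - w * p * Real.log T) atTop
      (𝓝 (w * p * (Real.log p - Real.log q))) := by
  rcases hp.eq_or_lt with rfl | hp
  · simp
  · have h1 : Tendsto (fun T : ℝ => q / T + p) atTop (𝓝 (0 + p)) :=
      (tendsto_const_nhds.div_atTop tendsto_id).add_const p
    rw [zero_add] at h1
    have h2 := ((h1.log hp.ne').sub_const (Real.log q)).const_mul (w * p)
    refine h2.congr' ?_
    have hne : ∀ᶠ T : ℝ in atTop, q / T + p ≠ 0 := h1.eventually_ne hp.ne'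
    filter_upwards [hne, eventually_gt_atTop 0] with T hT hT0
    have : q + T * p = T * (q / T + p) := by field_simp
    rw [this, Real.log_mul hT0.ne' hT]
    ring

/-- The relative entropy of `ρ` and `σ` as a renormalized integral over `t` of the maximum of
`resolventForm t ρ σ`. Here `Q t` is the maximum and `E` its primitive. -/
theorem exists_resolvent_representation {n : Type*} [Fintype n] [DecidableEq n]
    {ρ σ : Matrix n n ℂ} (hρ : ρ.PosSemidef) (hσ : σ.PosSemidef)
    (hker : ∀ v : n → ℂ, σ *ᵥ v = 0 → ρ *ᵥ v = 0) :
    ∃ E Q : ℝ → ℝ, (∀ t, 0 ≤ t → HasDerivAt E (Q t) t) ∧ E 0 = 0 ∧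
      Tendsto (fun T => E T - ρ.trace.re * Real.log T) atTop (𝓝 (umegaki ρ σ)) ∧
      ∀ t, 0 < t → IsGreatest (Set.range (resolventForm t ρ σ)) (Q t) := by
  obtain ⟨U, p, hU, hU', hp, hρU, hlogρ⟩ := exists_spectral_decomposition hρ
  obtain ⟨V, q, hV, hV', hq, hσV, hlogσ⟩ := exists_spectral_decomposition hσ
  -- `W` holds the overlaps of the two eigenbases. The weights `|W i j|²` sum to one along each row.
  set W := Uᴴ * V with hW
  have hWW : W * Wᴴ = 1 := by
    rw [hW, conjTranspose_mul, conjTranspose_conjTranspose, mul_assoc, ← mul_assoc V, hV,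
      one_mul, hU']
  have hrow : ∀ i, ∑ j, Complex.normSq (W i j) = 1 := by
    intro i
    have := congrArg Complex.re (congrFun (congrFun hWW i) i)
    rw [mul_apply, Complex.re_sum] at this
    simpa [Complex.normSq_apply] using this
  -- If `q j = 0`, the `j`-th eigenvector of `σ` lies in `ker σ`, hence in `ker ρ`, which forces `p
  -- i * W i j = 0`.
  have hsupp : ∀ i j, Complex.normSq (W i j) * p i ≠ 0 → 0 < q j := by
    intro i j h
    refine lt_of_le_of_ne (hq j) fun hqj => h ?_
    have h1 : σ *ᵥ (V *ᵥ Pi.single j 1) = 0 := by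
      rw [mulVec_mulVec, hσV, mul_assoc, hV', mul_one, ← mulVec_mulVec]
      have : diagonal (fun i => (q i : ℂ)) *ᵥ Pi.single j 1 = 0 := by
        ext k
        rw [mulVec_diagonal]
        by_cases hk : k = j
        · subst hk; simp [← hqj]
        · simp [hk]
      rw [this, mulVec_zero]
    have h2 := congrArg (fun v => (Uᴴ *ᵥ v) i) (hker _ h1)
    rw [hρU] at h2
    simp only [mulVec_mulVec, ← mul_assoc, hU', one_mul, mulVec_zero, Pi.zero_apply] at h2
    rw [mul_assoc, ← hW, mulVec_single_one, col_apply, diagonal_mul] at h2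
    rcases mul_eq_zero.mp h2 with h3 | h3
    · simp [Complex.ofReal_eq_zero.mp h3]
    · simp [h3]
  have htr : ρ.trace.re = ∑ i, ∑ j, Complex.normSq (W i j) * p i := by
    rw [hρU, trace_mul_comm, ← mul_assoc, hU', one_mul]
    simp_rw [← Finset.sum_mul, hrow, one_mul]
    simp [trace]
  have hD : umegaki ρ σ =
      ∑ i, ∑ j, Complex.normSq (W i j) * p i * (Real.log (p i) - Real.log (q j)) := by
    have h1 : (ρ * matrixLog ρ).trace.re = ∑ i, p i * Real.log (p i) := by
      rw [hlogρ]
      nth_rewrite 1 [hρU]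
      rw [← mul_assoc, trace_mul_comm]
      simp only [← mul_assoc, hU', one_mul]
      rw [mul_assoc _ Uᴴ U, hU', mul_one, trace_re_diagonal_mul]
      simp
    have h2 : (ρ * matrixLog σ).trace.re =
        ∑ i, p i * ∑ j, Complex.normSq (W i j) * Real.log (q j) := by
      rw [hlogσ]
      nth_rewrite 1 [hρU]
      have : (U * diagonal (fun i => (p i : ℂ)) * Uᴴ *
          (V * diagonal (fun i => (Real.log (q i) : ℂ)) * Vᴴ)).trace =
          (diagonal (fun i => (p i : ℂ)) *
            (W * diagonal (fun i => (Real.log (q i) : ℂ)) * Wᴴ)).trace := by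
        rw [mul_assoc U, mul_assoc U, trace_mul_comm, hW, conjTranspose_mul,
          conjTranspose_conjTranspose]
        simp only [mul_assoc]
      rw [this, trace_re_diagonal_mul]
      refine Finset.sum_congr rfl fun i _ => ?_
      rw [mul_apply, Complex.re_sum]
      congr 1
      refine Finset.sum_congr rfl fun j _ => ?_
      rw [mul_diagonal, conjTranspose_apply]
      simp only [Complex.normSq_apply, Complex.mul_re,
        Complex.mul_im, Complex.ofReal_re, Complex.ofReal_im, Complex.star_def, Complex.conj_re,
        Complex.conj_im]
      ring
    rw [umegaki, mul_sub, trace_sub, Complex.sub_re, h1, h2, ← Finset.sum_sub_distrib]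
    refine Finset.sum_congr rfl fun i _ => ?_
    simp_rw [mul_sub, Finset.sum_sub_distrib]
    rw [← Finset.sum_mul, ← Finset.sum_mul, hrow, one_mul, Finset.mul_sum]
    congr 1
    refine Finset.sum_congr rfl fun j _ => ?_
    ring
  refine ⟨fun T => ∑ i, ∑ j, Complex.normSq (W i j) * p i *
      (Real.log (q j + T * p i) - Real.log (q j)),
    fun t => ∑ i, ∑ j, p i ^ 2 * Complex.normSq (W i j) / (q j + t * p i), ?_, ?_, ?_, ?_⟩
  · intro t ht
    refine HasDerivAt.fun_sum fun i _ => HasDerivAt.fun_sum fun j _ => ?_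
    exact hasDerivAt_logTerm (hp i) (hsupp i j) ht
  · simp
  · rw [hD, htr]
    simp_rw [Finset.sum_mul, ← Finset.sum_sub_distrib]
    exact tendsto_finsetSum _ fun i _ => tendsto_finsetSum _ fun j _ => tendsto_logTerm (hp i)
  · intro t ht
    -- Since `t > 0`, a denominator can vanish only where the numerator does.
    have hden : ∀ i j, p i = 0 ∨ 0 < q j + t * p i := fun i j =>
      (hp i).eq_or_lt.imp Eq.symm fun h => by have := hq j; positivity
    constructor
    · refine ⟨V * (of fun j i => ((p i / (q j + t * p i) : ℝ) : ℂ) * star (W i j)) * Uᴴ, ?_⟩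
      rw [hρU, hσV, resolventForm_conj t p q hU' hV']
      refine Finset.sum_congr rfl fun i _ => Finset.sum_congr rfl fun j _ => ?_
      exact two_mul_re_sub_eq _ (hden i j)
    · rintro _ ⟨X, rfl⟩
      have hX : X = V * (Vᴴ * X * U) * Uᴴ := by
        simp only [← mul_assoc, hV, one_mul]
        rw [mul_assoc, hU, mul_one]
      rw [hX, hρU, hσV, resolventForm_conj t p q hU' hV']
      refine Finset.sum_le_sum fun i _ => Finset.sum_le_sum fun j _ => ?_
      have := mul_nonneg ht.le (hp i)
      exact two_mul_re_sub_le _ _ (hden i j) (add_nonneg (hq j) this)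

/-! ### Comparison of relative entropies through their resolvent forms -/

theorem nonneg_of_tendsto_of_hasDerivAt_nonneg {f f' : ℝ → ℝ} {l : ℝ} (h0 : f 0 = 0)
    (hf : ∀ t, 0 ≤ t → HasDerivAt f (f' t) t) (hf' : ∀ t, 0 < t → 0 ≤ f' t)
    (hl : Tendsto f atTop (𝓝 l)) : 0 ≤ l := by
  have hmono : MonotoneOn f (Set.Ici 0) := by
    refine monotoneOn_of_deriv_nonneg (convex_Ici 0)
      (fun t ht => (hf t ht).continuousAt.continuousWithinAt)
      (fun t ht => ?_) fun t ht => ?_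
    · rw [interior_Ici] at ht
      exact (hf t (le_of_lt ht)).differentiableAt.differentiableWithinAt
    · rw [interior_Ici] at ht
      rw [(hf t (le_of_lt ht)).deriv]
      exact hf' t ht
  refine ge_of_tendsto hl ?_
  filter_upwards [eventually_ge_atTop 0] with t ht
  rw [← h0]
  exact hmono Set.self_mem_Ici ht ht

/-- Every value of the first form is a value of the second, so the maxima are ordered for each `t`.
Equal traces make the `log T` terms cancel. -/
theorem umegaki_le_of_resolventForm_le {m n : Type*} [Fintype m] [DecidableEq m] [Fintype n]
    [DecidableEq n] {ρ σ : Matrix m m ℂ} {ρ' σ' : Matrix n n ℂ}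
    (hρ : ρ.PosSemidef) (hσ : σ.PosSemidef) (hker : ∀ v, σ *ᵥ v = 0 → ρ *ᵥ v = 0)
    (hρ' : ρ'.PosSemidef) (hσ' : σ'.PosSemidef) (hker' : ∀ v, σ' *ᵥ v = 0 → ρ' *ᵥ v = 0)
    (htr : ρ.trace = ρ'.trace)
    (h : ∀ t X, ∃ Y, resolventForm t ρ σ X = resolventForm t ρ' σ' Y) :
    umegaki ρ σ ≤ umegaki ρ' σ' := by
  obtain ⟨E, Q, hE, hE0, hEl, hQ⟩ := exists_resolvent_representation hρ hσ hker
  obtain ⟨E', Q', hE', hE0', hEl', hQ'⟩ := exists_resolvent_representation hρ' hσ' hker'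
  rw [← sub_nonneg]
  refine nonneg_of_tendsto_of_hasDerivAt_nonneg (f := fun t => E' t - E t)
    (f' := fun t => Q' t - Q t) (by simp [hE0, hE0'])
    (fun t ht => (hE' t ht).sub (hE t ht)) (fun t ht => ?_) ?_
  · obtain ⟨X, hX⟩ := (hQ t ht).1
    obtain ⟨Y, hY⟩ := h t X
    rw [sub_nonneg, ← hX, hY]
    exact (hQ' t ht).2 ⟨Y, rfl⟩
  · refine (hEl'.sub hEl).congr fun T => ?_
    rw [htr]; ring

theorem resolventForm_combo {n : Type*} [Fintype n] (t a b : ℝ) (ρ σ ρ' σ' X : Matrix n n ℂ) :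
    resolventForm t (a • ρ + b • ρ') (a • σ + b • σ') X =
      a * resolventForm t ρ σ X + b * resolventForm t ρ' σ' X := by
  simp only [resolventForm, add_mul, smul_mul, trace_add, trace_smul, Complex.add_re,
    Complex.smul_re, smul_eq_mul]
  ring

/-- Joint convexity of the relative entropy. -/
theorem umegaki_combo_le {n : Type*} [Fintype n] [DecidableEq n] {ρ σ ρ' σ' : Matrix n n ℂ}
    (hρ : ρ.PosSemidef) (hσ : σ.PosSemidef) (hker : ∀ v, σ *ᵥ v = 0 → ρ *ᵥ v = 0)
    (hρ' : ρ'.PosSemidef) (hσ' : σ'.PosSemidef) (hker' : ∀ v, σ' *ᵥ v = 0 → ρ' *ᵥ v = 0)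
    {a b : ℝ} (ha : 0 ≤ a) (hb : 0 ≤ b)
    (hker'' : ∀ v, (a • σ + b • σ') *ᵥ v = 0 → (a • ρ + b • ρ') *ᵥ v = 0) :
    umegaki (a • ρ + b • ρ') (a • σ + b • σ') ≤ a * umegaki ρ σ + b * umegaki ρ' σ' := by
  obtain ⟨E, Q, hE, hE0, hEl, hQ⟩ := exists_resolvent_representation hρ hσ hker
  obtain ⟨E', Q', hE', hE0', hEl', hQ'⟩ := exists_resolvent_representation hρ' hσ' hker'
  obtain ⟨F, R, hF, hF0, hFl, hR⟩ := exists_resolvent_representation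
    ((hρ.smul ha).add (hρ'.smul hb)) ((hσ.smul ha).add (hσ'.smul hb)) hker''
  rw [← sub_nonneg]
  refine nonneg_of_tendsto_of_hasDerivAt_nonneg (f := fun t => a * E t + b * E' t - F t)
    (f' := fun t => a * Q t + b * Q' t - R t) (by simp [hE0, hE0', hF0])
    (fun t ht => (((hE t ht).const_mul a).add ((hE' t ht).const_mul b)).sub (hF t ht))
    (fun t ht => ?_) ?_
  · obtain ⟨X, hX⟩ := (hR t ht).1
    rw [sub_nonneg, ← hX, resolventForm_combo]
    exact add_le_add (mul_le_mul_of_nonneg_left ((hQ t ht).2 ⟨X, rfl⟩) ha)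
      (mul_le_mul_of_nonneg_left ((hQ' t ht).2 ⟨X, rfl⟩) hb)
  · refine (((hEl.const_mul a).add (hEl'.const_mul b)).sub hFl).congr fun T => ?_
    simp only [trace_add, trace_smul, Complex.add_re, Complex.smul_re, smul_eq_mul]
    ring

/-! ### Restriction of states along *-homomorphisms -/

section StarAlgHom

variable {m n : Type*} [Fintype m] [DecidableEq m] [Fintype n] [DecidableEq n]

open scoped MatrixOrder Matrix.Norms.L2Operator in
theorem _root_.Matrix.PosSemidef.map_starAlgHom {A : Matrix m m ℂ} (hA : A.PosSemidef)
    (φ : Matrix m m ℂ →⋆ₐ[ℂ] Matrix n n ℂ) : (φ A).PosSemidef := by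
  obtain ⟨B, rfl⟩ := CStarAlgebra.nonneg_iff_eq_star_mul_self.mp hA.nonneg
  rw [map_mul, map_star]
  exact posSemidef_conjTranspose_mul_self _

theorem matrixLog_map_starAlgHom {A : Matrix m m ℂ} (hA : A.PosSemidef)
    (φ : Matrix m m ℂ →⋆ₐ[ℂ] Matrix n n ℂ) : φ (matrixLog A) = matrixLog (φ A) :=
  φ.map_cfc Real.log A (A.finite_real_spectrum.continuousOn _)
    (LinearMap.continuous_of_finiteDimensional φ.toAlgHom.toLinearMap) hA.1
    (hA.map_starAlgHom φ).1

/-- Monotonicity of the relative entropy under restriction of states to a subalgebra. -/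
theorem umegaki_mono_of_starAlgHom {ρ σ : Matrix m m ℂ} {ρ' σ' : Matrix n n ℂ}
    (φ : Matrix m m ℂ →⋆ₐ[ℂ] Matrix n n ℂ)
    (hρ : ρ.PosSemidef) (hσ : σ.PosSemidef) (hker : ∀ v, σ *ᵥ v = 0 → ρ *ᵥ v = 0)
    (hρ' : ρ'.PosSemidef) (hσ' : σ'.PosSemidef) (hker' : ∀ v, σ' *ᵥ v = 0 → ρ' *ᵥ v = 0)
    (hφρ : ∀ X, (ρ' * φ X).trace = (ρ * X).trace)
    (hφσ : ∀ X, (σ' * φ X).trace = (σ * X).trace) :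
    umegaki ρ σ ≤ umegaki ρ' σ' := by
  refine umegaki_le_of_resolventForm_le hρ hσ hker hρ' hσ' hker' ?_ fun t X => ⟨φ X, ?_⟩
  · simpa using (hφρ 1).symm
  · simp only [resolventForm, ← star_eq_conjTranspose, ← map_star, ← map_mul, hφρ, hφσ]

/-- The bridge from relative entropy to entropy differences: `log (φ τ) = φ (log τ)`, and testing
`ρ` against the image of `φ` only sees its restriction `τ`. -/
theorem umegaki_starAlgHom_right {ρ : Matrix n n ℂ} {τ : Matrix m m ℂ} (hτ : τ.PosSemidef)
    (φ : Matrix m m ℂ →⋆ₐ[ℂ] Matrix n n ℂ) (hφ : ∀ X, (ρ * φ X).trace = (τ * X).trace) :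
    umegaki ρ (φ τ) = entropy τ - entropy ρ := by
  rw [umegaki, mul_sub, trace_sub, ← matrixLog_map_starAlgHom hτ, hφ, entropy, entropy,
    Complex.sub_re]
  ring

end StarAlgHom

/-! ### Partial traces, their dual embeddings, and kernels -/

section PartialTrace

variable {m n : Type u} [Fintype m] [Fintype n]

/-- The embedding `X ↦ 1 ⊗ X`. -/
def oneKronecker (m n : Type*) [Fintype m] [DecidableEq m] [Fintype n] [DecidableEq n] :
    Matrix n n ℂ →⋆ₐ[ℂ] Matrix (m × n) (m × n) ℂ where
  toFun X := (1 : Matrix m m ℂ) ⊗ₖ X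
  map_one' := one_kronecker_one
  map_mul' X Y := by rw [← mul_kronecker_mul, one_mul]
  map_zero' := kronecker_zero _
  map_add' X Y := kronecker_add _ _ _
  commutes' r := by
    simp only [Algebra.algebraMap_eq_smul_one]
    rw [kronecker_smul, one_kronecker_one]
  map_star' X := by
    simp only [star_eq_conjTranspose, conjTranspose_kronecker, conjTranspose_one]

/-- The embedding `X ↦ X ⊗ 1`. -/
def kroneckerOne (m n : Type*) [Fintype m] [DecidableEq m] [Fintype n] [DecidableEq n] :
    Matrix m m ℂ →⋆ₐ[ℂ] Matrix (m × n) (m × n) ℂ where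
  toFun X := X ⊗ₖ (1 : Matrix n n ℂ)
  map_one' := one_kronecker_one
  map_mul' X Y := by rw [← mul_kronecker_mul, one_mul]
  map_zero' := zero_kronecker _
  map_add' X Y := add_kronecker _ _ _
  commutes' r := by
    simp only [Algebra.algebraMap_eq_smul_one]
    rw [smul_kronecker, one_kronecker_one]
  map_star' X := by
    simp only [star_eq_conjTranspose, conjTranspose_kronecker, conjTranspose_one]

/-- Relabelling of the index set. -/
def reindexStarAlgHom {m n : Type*} [Fintype m] [DecidableEq m] [Fintype n] [DecidableEq n]
    (e : m ≃ n) : Matrix m m ℂ →⋆ₐ[ℂ] Matrix n n ℂ where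
  __ := (reindexAlgEquiv ℂ ℂ e).toAlgHom
  map_star' X := by
    simp [star_eq_conjTranspose]

theorem trace_reindex {m n : Type*} [Fintype m] [Fintype n] (e : m ≃ n) (A : Matrix m m ℂ) :
    (reindex e e A).trace = A.trace := by
  simp only [trace, diag_apply, reindex_apply, submatrix_apply]
  exact Equiv.sum_comp e.symm fun i => A i i

theorem entropy_reindex {m n : Type*} [Fintype m] [DecidableEq m] [Fintype n] [DecidableEq n]
    (e : m ≃ n) {A : Matrix m m ℂ} (hA : A.PosSemidef) :
    entropy (reindex e e A) = entropy A := by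
  change entropy (reindexStarAlgHom e A) = _
  rw [entropy, ← matrixLog_map_starAlgHom hA, ← map_mul]
  exact congrArg (fun z : ℂ => -z.re) (trace_reindex e _)

theorem trace_mul_oneKronecker [DecidableEq m] [DecidableEq n] (ρ : Matrix (m × n) (m × n) ℂ)
    (X : Matrix n n ℂ) : (ρ * oneKronecker m n X).trace = (ptraceFst ρ * X).trace := by
  simp only [trace, diag_apply, mul_apply, ptraceFst, of_apply, Fintype.sum_prod_type,
    Finset.sum_mul]
  rw [Finset.sum_comm]
  refine Finset.sum_congr rfl fun j _ => ?_
  rw [Finset.sum_comm]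
  rw [Finset.sum_comm]
  rw [Finset.sum_comm (s := Finset.univ (α := n))]
  refine Finset.sum_congr rfl fun i _ => ?_
  rw [Finset.sum_eq_single i]
  · simp [oneKronecker]
  · intro k _ hk
    simp [oneKronecker, one_apply_ne hk]
  · simp

theorem trace_mul_kroneckerOne [DecidableEq m] [DecidableEq n] (ρ : Matrix (m × n) (m × n) ℂ)
    (X : Matrix m m ℂ) : (ρ * kroneckerOne m n X).trace = (ptraceSnd ρ * X).trace := by
  simp only [trace, diag_apply, mul_apply, ptraceSnd, of_apply, Fintype.sum_prod_type,
    Finset.sum_mul]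
  refine Finset.sum_congr rfl fun i _ => ?_
  rw [Finset.sum_comm]
  refine Finset.sum_congr rfl fun k _ => ?_
  refine Finset.sum_congr rfl fun j _ => ?_
  rw [Finset.sum_eq_single j]
  · simp [kroneckerOne]
  · intro l _ hl
    simp [kroneckerOne, one_apply_ne hl]
  · simp

theorem ptraceSnd_eq_ptraceFst_swap {m n : Type u} [Fintype n] (ρ : Matrix (m × n) (m × n) ℂ) :
    ptraceSnd ρ = ptraceFst (reindex (Equiv.prodComm m n) (Equiv.prodComm m n) ρ) := rfl

theorem posSemidef_ptraceFst {m n : Type u} [Fintype m] {ρ : Matrix (m × n) (m × n) ℂ} (hρ : ρ.PosSemidef) :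
    (ptraceFst ρ).PosSemidef := by
  have : ptraceFst ρ = ∑ i, ρ.submatrix (Prod.mk i) (Prod.mk i) := by
    ext j j'
    simp [ptraceFst, Matrix.sum_apply]
  rw [this]
  exact posSemidef_sum _ fun i _ => hρ.submatrix _

theorem _root_.Matrix.PosSemidef.reindex {m n : Type*} {A : Matrix m m ℂ} (hA : A.PosSemidef)
    (e : m ≃ n) : (Matrix.reindex e e A).PosSemidef :=
  hA.submatrix _

theorem posSemidef_ptraceSnd {m n : Type u} [Fintype n] {ρ : Matrix (m × n) (m × n) ℂ} (hρ : ρ.PosSemidef) :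
    (ptraceSnd ρ).PosSemidef := by
  rw [ptraceSnd_eq_ptraceFst_swap]
  exact posSemidef_ptraceFst (hρ.reindex _)

/-- The vector `eᵢ ⊗ v`. -/
def singleTensor {m n : Type*} [DecidableEq m] (i : m) (v : n → ℂ) : m × n → ℂ :=
  fun x => if x.1 = i then v x.2 else 0

theorem mulVec_singleTensor [DecidableEq m] (ρ : Matrix (m × n) (m × n) ℂ) (i : m) (v : n → ℂ)
    (x : m × n) : (ρ *ᵥ singleTensor i v) x = ∑ j, ρ x (i, j) * v j := by
  simp only [mulVec, dotProduct, Fintype.sum_prod_type, singleTensor]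
  rw [Finset.sum_eq_single i]
  · simp
  · intro k _ hk
    simp [hk]
  · simp

theorem sum_dotProduct_singleTensor [DecidableEq m] (ρ : Matrix (m × n) (m × n) ℂ)
    (v : n → ℂ) :
    ∑ i, star (singleTensor i v) ⬝ᵥ (ρ *ᵥ singleTensor i v) =
      star v ⬝ᵥ (ptraceFst ρ *ᵥ v) := by
  have h : ∀ i : m, star (singleTensor i v) ⬝ᵥ (ρ *ᵥ singleTensor i v) =
      ∑ j, ∑ j', star (v j) * (ρ (i, j) (i, j') * v j') := by
    intro i
    simp only [dotProduct, Fintype.sum_prod_type, mulVec_singleTensor]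
    rw [Finset.sum_eq_single i]
    · simp [singleTensor, Finset.mul_sum]
    · intro k _ hk
      simp [singleTensor, hk]
    · simp
  simp_rw [h]
  rw [Finset.sum_comm]
  simp only [dotProduct, mulVec, ptraceFst, of_apply, Pi.star_apply, Finset.mul_sum,
    Finset.sum_mul]
  exact Finset.sum_congr rfl fun j _ => Finset.sum_comm

/-- A positive semidefinite matrix kills exactly the vectors on which its quadratic form vanishes.
The form of `ρ₂` at `v` is the sum of the nonnegative values of that of `ρ` at `eᵢ ⊗ v`. -/
theorem ptraceFst_mulVec_eq_zero_iff [DecidableEq m] {ρ : Matrix (m × n) (m × n) ℂ}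
    (hρ : ρ.PosSemidef) (v : n → ℂ) :
    ptraceFst ρ *ᵥ v = 0 ↔ ∀ i, ρ *ᵥ singleTensor i v = 0 := by
  classical
  rw [← (posSemidef_ptraceFst hρ).dotProduct_mulVec_zero_iff, ← sum_dotProduct_singleTensor,
    Finset.sum_eq_zero_iff_of_nonneg fun i _ => hρ.dotProduct_mulVec_nonneg _]
  simp only [Finset.mem_univ, true_imp_iff, hρ.dotProduct_mulVec_zero_iff]

theorem ker_ptraceFst_le {ρ σ : Matrix (m × n) (m × n) ℂ}
    (hρ : ρ.PosSemidef) (hσ : σ.PosSemidef) (h : ∀ v, σ *ᵥ v = 0 → ρ *ᵥ v = 0)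
    (v : n → ℂ) (hv : ptraceFst σ *ᵥ v = 0) : ptraceFst ρ *ᵥ v = 0 := by
  classical
  rw [ptraceFst_mulVec_eq_zero_iff hσ] at hv
  exact (ptraceFst_mulVec_eq_zero_iff hρ v).mpr fun i => h _ (hv i)

theorem reindex_mulVec_eq_zero_iff {m n : Type*} [Fintype m] [Fintype n] (e : m ≃ n)
    (A : Matrix m m ℂ) (v : n → ℂ) : reindex e e A *ᵥ v = 0 ↔ A *ᵥ (v ∘ e) = 0 := by
  rw [reindex_apply, submatrix_mulVec_equiv, Equiv.symm_symm]
  constructor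
  · intro h
    ext i
    simpa using congrFun h (e i)
  · intro h
    rw [h]; rfl

theorem ker_reindex_le {m n : Type*} [Fintype m] [Fintype n] (e : m ≃ n) {ρ σ : Matrix m m ℂ}
    (h : ∀ v, σ *ᵥ v = 0 → ρ *ᵥ v = 0) (v : n → ℂ) (hv : reindex e e σ *ᵥ v = 0) :
    reindex e e ρ *ᵥ v = 0 := by
  rw [reindex_mulVec_eq_zero_iff] at hv ⊢
  exact h _ hv

theorem ker_ptraceSnd_le {ρ σ : Matrix (m × n) (m × n) ℂ}
    (hρ : ρ.PosSemidef) (hσ : σ.PosSemidef) (h : ∀ v, σ *ᵥ v = 0 → ρ *ᵥ v = 0)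
    (v : m → ℂ) (hv : ptraceSnd σ *ᵥ v = 0) : ptraceSnd ρ *ᵥ v = 0 := by
  rw [ptraceSnd_eq_ptraceFst_swap] at hv ⊢
  exact ker_ptraceFst_le (hρ.reindex _) (hσ.reindex _) (ker_reindex_le _ h) v hv

/-- Ensures that `D(ρ‖1 ⊗ ρ₂)` is finite. Each slice of `v` lies in `ker ρ₂`, so `ρ` kills every
summand `eᵢ ⊗ vᵢ` of `v`. -/
theorem ker_oneKronecker_ptraceFst_le [DecidableEq m] [DecidableEq n]
    {ρ : Matrix (m × n) (m × n) ℂ} (hρ : ρ.PosSemidef) (v : m × n → ℂ)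
    (hv : oneKronecker m n (ptraceFst ρ) *ᵥ v = 0) : ρ *ᵥ v = 0 := by
  have hslice : ∀ i, ptraceFst ρ *ᵥ (fun j => v (i, j)) = 0 := by
    intro i
    ext j
    have := congrFun hv (i, j)
    simp only [mulVec, dotProduct, Fintype.sum_prod_type] at this ⊢
    rw [Finset.sum_eq_single i] at this
    · simpa [oneKronecker] using this
    · intro k _ hk
      simp [oneKronecker, one_apply_ne hk.symm]
    · simp
  have hsum : v = ∑ i, singleTensor i fun j => v (i, j) := by
    ext ⟨i, j⟩
    simp [singleTensor, Finset.sum_apply]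
  rw [hsum, mulVec_sum]
  exact Finset.sum_eq_zero fun i _ => (ptraceFst_mulVec_eq_zero_iff hρ _).mp (hslice i) i

theorem reindex_prodComm_kroneckerOne [DecidableEq m] [DecidableEq n] (A : Matrix m m ℂ) :
    reindex (Equiv.prodComm m n) (Equiv.prodComm m n) (kroneckerOne m n A) =
      oneKronecker n m A := by
  ext ⟨j, i⟩ ⟨j', i'⟩
  simp [kroneckerOne, oneKronecker, mul_comm]

theorem ker_kroneckerOne_ptraceSnd_le [DecidableEq m] [DecidableEq n]
    {ρ : Matrix (m × n) (m × n) ℂ} (hρ : ρ.PosSemidef) (v : m × n → ℂ)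
    (hv : kroneckerOne m n (ptraceSnd ρ) *ᵥ v = 0) : ρ *ᵥ v = 0 := by
  let e := Equiv.prodComm m n
  have h := ker_oneKronecker_ptraceFst_le (hρ.reindex e) (v ∘ e.symm)
  rw [← ptraceSnd_eq_ptraceFst_swap, ← reindex_prodComm_kroneckerOne,
    reindex_mulVec_eq_zero_iff, reindex_mulVec_eq_zero_iff] at h
  exact h hv

theorem umegaki_ptraceFst_le [DecidableEq m] [DecidableEq n] {ρ σ : Matrix (m × n) (m × n) ℂ}
    (hρ : ρ.PosSemidef) (hσ : σ.PosSemidef) (h : ∀ v, σ *ᵥ v = 0 → ρ *ᵥ v = 0) :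
    umegaki (ptraceFst ρ) (ptraceFst σ) ≤ umegaki ρ σ :=
  umegaki_mono_of_starAlgHom (oneKronecker m n) (posSemidef_ptraceFst hρ)
    (posSemidef_ptraceFst hσ) (ker_ptraceFst_le hρ hσ h) hρ hσ h
    (trace_mul_oneKronecker ρ) (trace_mul_oneKronecker σ)

theorem umegaki_ptraceSnd_le [DecidableEq m] [DecidableEq n] {ρ σ : Matrix (m × n) (m × n) ℂ}
    (hρ : ρ.PosSemidef) (hσ : σ.PosSemidef) (h : ∀ v, σ *ᵥ v = 0 → ρ *ᵥ v = 0) :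
    umegaki (ptraceSnd ρ) (ptraceSnd σ) ≤ umegaki ρ σ :=
  umegaki_mono_of_starAlgHom (kroneckerOne m n) (posSemidef_ptraceSnd hρ)
    (posSemidef_ptraceSnd hσ) (ker_ptraceSnd_le hρ hσ h) hρ hσ h
    (trace_mul_kroneckerOne ρ) (trace_mul_kroneckerOne σ)

theorem entropyDiff_eq_umegaki [DecidableEq m] [DecidableEq n] {ρ : Matrix (m × n) (m × n) ℂ}
    (hρ : ρ.PosSemidef) :
    entropyDiff ρ = umegaki ρ (oneKronecker m n (ptraceFst ρ)) :=
  (umegaki_starAlgHom_right (posSemidef_ptraceFst hρ) _ (trace_mul_oneKronecker ρ)).symm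

theorem ptraceFst_combo {m n : Type u} [Fintype m] (a b : ℝ) (ρ ρ' : Matrix (m × n) (m × n) ℂ) :
    ptraceFst (a • ρ + b • ρ') = a • ptraceFst ρ + b • ptraceFst ρ' := by
  ext j j'
  simp [ptraceFst, Finset.sum_add_distrib, Finset.mul_sum]

theorem ptraceFst_smul {m n : Type u} [Fintype m] (a : ℝ) (ρ : Matrix (m × n) (m × n) ℂ) :
    ptraceFst (a • ρ) = a • ptraceFst ρ := by
  ext j j'
  simp [ptraceFst, Finset.mul_sum]

theorem trace_ptraceFst (ρ : Matrix (m × n) (m × n) ℂ) : (ptraceFst ρ).trace = ρ.trace := by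
  simp only [trace, diag_apply, ptraceFst, of_apply, Fintype.sum_prod_type]
  exact Finset.sum_comm

end PartialTrace

/-! ### Scaling of the entropy and the three statements -/

theorem entropy_eq_neg_trace_cfc {n : Type*} [Fintype n] [DecidableEq n] {ρ : Matrix n n ℂ}
    (hρ : ρ.PosSemidef) : entropy ρ = -(cfc (fun x : ℝ => x * Real.log x) ρ).trace.re := by
  rw [cfc_mul (fun x => x) Real.log ρ (ρ.finite_real_spectrum.continuousOn _)
    (ρ.finite_real_spectrum.continuousOn _), cfc_id' ℝ ρ hρ.1.isSelfAdjoint]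
  rfl

/-- The correction to homogeneity depends on `ρ` only through its trace, which the partial trace
preserves. It therefore cancels in `entropyDiff`. -/
theorem entropy_smul {n : Type*} [Fintype n] [DecidableEq n] {ρ : Matrix n n ℂ}
    (hρ : ρ.PosSemidef) {t : ℝ} (ht : 0 ≤ t) :
    entropy (t • ρ) = t * entropy ρ - t * Real.log t * ρ.trace.re := by
  have hc : ∀ f : ℝ → ℝ, ContinuousOn f (spectrum ℝ ρ) := fun f =>
    ρ.finite_real_spectrum.continuousOn _
  rw [entropy_eq_neg_trace_cfc (hρ.smul ht), entropy_eq_neg_trace_cfc hρ,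
    ← cfc_comp_const_mul t (fun x => x * Real.log x) ρ
      ((ρ.finite_real_spectrum.image _).continuousOn _) hρ.1.isSelfAdjoint]
  have : (fun x => t * x * Real.log (t * x)) =
      fun x => t * (x * Real.log x) + t * Real.log t * x := by
    ext x
    rcases eq_or_ne t 0 with rfl | h1
    · simp
    rcases eq_or_ne x 0 with rfl | h2
    · simp
    rw [Real.log_mul h1 h2]
    ring
  rw [this, cfc_add _ _ _ (hc _) (hc _), cfc_const_mul _ _ _ (hc _), cfc_const_mul _ _ _ (hc _),
    cfc_id' ℝ ρ hρ.1.isSelfAdjoint]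
  simp only [trace_add, trace_smul, Complex.add_re, Complex.smul_re, smul_eq_mul]
  ring

theorem convexOn_entropyDiff_posSemidef (a b : Type u) [Fintype a] [DecidableEq a] [Fintype b]
    [DecidableEq b] :
    ConvexOn ℝ {ρ : Matrix (a × b) (a × b) ℂ | ρ.PosSemidef} entropyDiff := by
  have hadd : ∀ ρ : Matrix (a × b) (a × b) ℂ, ρ.PosSemidef → ∀ ρ' : Matrix (a × b) (a × b) ℂ,
      ρ'.PosSemidef → ∀ s t : ℝ, 0 ≤ s → 0 ≤ t → (s • ρ + t • ρ').PosSemidef :=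
    fun ρ hρ ρ' hρ' s t hs ht => (hρ.smul hs).add (hρ'.smul ht)
  refine ⟨fun ρ hρ ρ' hρ' s t hs ht _ => hadd ρ hρ ρ' hρ' s t hs ht,
    fun ρ hρ ρ' hρ' s t hs ht _ => ?_⟩
  have hρ : ρ.PosSemidef := hρ
  have hρ' : ρ'.PosSemidef := hρ'
  have hsum := hadd ρ hρ ρ' hρ' s t hs ht
  have hreal : ∀ (r : ℝ) (X : Matrix b b ℂ),
      oneKronecker a b (r • X) = r • oneKronecker a b X := fun r X => by
    ext ⟨i, j⟩ ⟨i', j'⟩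
    simp [oneKronecker]
    ring
  have hlin : oneKronecker a b (ptraceFst (s • ρ + t • ρ')) =
      s • oneKronecker a b (ptraceFst ρ) + t • oneKronecker a b (ptraceFst ρ') := by
    rw [ptraceFst_combo, map_add, hreal, hreal]
  have hker := ker_oneKronecker_ptraceFst_le hsum
  rw [entropyDiff_eq_umegaki hρ, entropyDiff_eq_umegaki hρ', entropyDiff_eq_umegaki hsum]
  rw [hlin] at hker ⊢
  exact umegaki_combo_le hρ ((posSemidef_ptraceFst hρ).map_starAlgHom _)
    (ker_oneKronecker_ptraceFst_le hρ) hρ' ((posSemidef_ptraceFst hρ').map_starAlgHom _)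
    (ker_oneKronecker_ptraceFst_le hρ') hs ht hker

theorem convex_isDensityMatrix (n : Type u) [Fintype n] :
    Convex ℝ {ρ : Matrix n n ℂ | IsDensityMatrix ρ} := by
  intro ρ hρ ρ' hρ' s t hs ht hst
  refine ⟨(hρ.1.smul hs).add (hρ'.1.smul ht), ?_⟩
  rw [trace_add, trace_smul, trace_smul, hρ.2, hρ'.2, ← add_smul, hst, one_smul]

theorem entropyDiffConvexHomogeneous : EntropyDiffConvexHomogeneous.{u} := by
  intro a b _ _ _ _
  refine ⟨(convexOn_entropyDiff_posSemidef a b).subset (fun ρ hρ => hρ.1)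
    (convex_isDensityMatrix _), convexOn_entropyDiff_posSemidef a b, fun ρ hρ t ht => ?_⟩
  rw [entropyDiff, entropyDiff, ptraceFst_smul, entropy_smul hρ ht,
    entropy_smul (posSemidef_ptraceFst hρ) ht, trace_ptraceFst]
  ring

theorem relativeEntropyMonotone : RelativeEntropyMonotone.{u} := by
  intro a b _ _ _ _ ρ σ hρ hσ
  by_cases h : ∀ v, σ *ᵥ v = 0 → ρ *ᵥ v = 0
  · simp only [relativeEntropy, if_pos h, if_pos (ker_ptraceFst_le hρ.1 hσ.1 h),
      if_pos (ker_ptraceSnd_le hρ.1 hσ.1 h), EReal.coe_le_coe_iff]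
    exact ⟨umegaki_ptraceSnd_le hρ.1 hσ.1 h, umegaki_ptraceFst_le hρ.1 hσ.1 h⟩
  -- Without the kernel inclusion the right-hand sides are `⊤`.
  · simp [relativeEntropy, if_neg h]

/-- Tracing out the first factor gives `D(ρ₂₃‖ρ₂ ⊗ 1) ≤ D(ρ₁₂₃‖ρ₁₂ ⊗ 1)`, which reads `S₂ - S₂₃ ≤
S₁₂ - S₁₂₃`. -/
theorem strongSubadditivity : StrongSubadditivity.{u} := by
  intro a b c _ _ _ _ _ _ ρ hρ ρ₁₂ ρ₂₃ ρ₂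
  let e := (Equiv.prodAssoc a b c).symm
  let ρ' := reindex e e ρ
  have hρ' : ρ'.PosSemidef := hρ.1.reindex e
  have h12 : ρ₁₂.PosSemidef := posSemidef_ptraceSnd hρ'
  have h23 : ρ₂₃.PosSemidef := posSemidef_ptraceFst hρ.1
  have h2 : ρ₂.PosSemidef := posSemidef_ptraceFst h12
  have h2' : ptraceSnd ρ₂₃ = ρ₂ := by
    ext j j'
    exact Finset.sum_comm
  have htr : ∀ (τ : Matrix (a × b × c) (a × b × c) ℂ) X,
      (reindex e e τ * ((reindexStarAlgHom e).comp (oneKronecker a (b × c))) X).trace =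
        (ptraceFst τ * X).trace := by
    intro τ X
    rw [← trace_mul_oneKronecker, ← trace_reindex e]
    exact congrArg trace (map_mul (reindexStarAlgHom e) τ _).symm
  -- Regrouped over `a × (b × c)`, the matrix `ρ₁₂ ⊗ 1` can be traced over `a`, which leaves `ρ₂ ⊗
  -- 1`.
  have hσ : reindex e e (reindex e.symm e.symm (kroneckerOne (a × b) c ρ₁₂)) =
      kroneckerOne (a × b) c ρ₁₂ := by
    ext
    simp
  have hσ' : ptraceFst (reindex e.symm e.symm (kroneckerOne (a × b) c ρ₁₂)) =
      kroneckerOne b c ρ₂ := by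
    ext ⟨j, k⟩ ⟨j', k'⟩
    simp [ptraceFst, kroneckerOne, e, ρ₂, Finset.sum_mul]
  have hmono : umegaki ρ₂₃ (kroneckerOne b c ρ₂) ≤ umegaki ρ' (kroneckerOne (a × b) c ρ₁₂) := by
    refine umegaki_mono_of_starAlgHom ((reindexStarAlgHom e).comp (oneKronecker a (b × c)))
      h23 (h2.map_starAlgHom _) ?_ hρ' (h12.map_starAlgHom _)
      (ker_kroneckerOne_ptraceSnd_le hρ') (htr ρ) ?_
    · rw [← h2']
      exact ker_kroneckerOne_ptraceSnd_le h23
    · intro X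
      rw [← hσ', ← htr, hσ]
  rw [umegaki_starAlgHom_right h2 _ fun X => by rw [trace_mul_kroneckerOne, h2'],
    umegaki_starAlgHom_right h12 _ (trace_mul_kroneckerOne ρ'), entropy_reindex e hρ.1] at hmono
  linarith

end

end QuantumEntropy

theorem theorem4p2 :
    (QuantumEntropy.StrongSubadditivity.{u} ∧
      QuantumEntropy.EntropyDiffConvexHomogeneous.{u} ∧
      QuantumEntropy.RelativeEntropyMonotone.{u}) ∧
    List.TFAE [QuantumEntropy.StrongSubadditivity.{u},
      QuantumEntropy.EntropyDiffConvexHomogeneous.{u},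
      QuantumEntropy.RelativeEntropyMonotone.{u}] := by
  have h1 := QuantumEntropy.strongSubadditivity.{u}
  have h2 := QuantumEntropy.entropyDiffConvexHomogeneous.{u}
  have h3 := QuantumEntropy.relativeEntropyMonotone.{u}
  refine ⟨⟨h1, h2, h3⟩, ?_⟩
  -- All three statements are proved outright, so each is equivalent to `True`.
  exact List.tfae_of_forall True _ (by simp [h1, h2, h3])
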